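/- Throughout, groups are finite. Let $p$ be a prime, let $G$ be a $p$-solvable group (that is, $G$ has a series of normal subgroups from $1$ to $G$ each of whose factors is a $p$-group or a $p'$-group), and let $P$ be a Sylow $p$-subgroup of $G$. For a finite group $H$ and $y\in H$, let $\lambda_H(y)$ be the number of Sylow $p$-subgroups of $H$ containing $y$, and let $\mathrm{Irr}(H)$ be the set of irreducible complex characters of $H$. An identification of the character table of $G$ with that of $H$ is a pair consisting of a bijection $\chi\mapsto\chi^*$ from $\mathrm{Irr}(G)$ to $\mathrm{Irr}(H)$ and a bijection $K\mapsto K^*$ from the conjugacy classes of $G$ to those of $H$ such that $\chi^*(K^*)=\chi(K)$ for all $\chi$ and $K$; $G$ and $H$ have the same character table if there is one. We say that the character table of $G$ determines $|\mathbf{N}_G(P)|$ if $|\mathbf{N}_H(Q)|=|\mathbf{N}_G(P)|$ for every finite group $H$ with the same character table as $G$ and every Sylow $p$-subgroup $Q$ of $H$. For $x\in G$, we say that it determines $\lambda_G(x)$ if $\lambda_H(y)=\lambda_G(x)$ for every finite group $H$, every identification of the character table of $G$ with that of $H$, and every $y$ in the class of $H$ corresponding to the class of $x$. It determines the function $\lambda_G$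 if it determines $\lambda_G(x)$ for every $x\in G$. Consider the following statements. 1. The character table of $G$ determines $|\mathbf{N}_G(P)|$. 2. The character table of $G$ determines the function $\lambda_G$. 3. The character table of $G$ determines $\lambda_G(x)$ for some nonidentity $p$-element $x\in G$. Then (1) and (2) are equivalent, and if $p$ divides $|G|$, then (1), (2) and (3) are equivalent. -/

import Mathlib

/-- `G` is `p`-solvable: it has a finite series of normal subgroups, from the trivial subgroup
to `G`, every factor of which has order a power of `p` or order prime to `p`. -/
def IsPSolvable (p : ℕ) (G : Type*) [Group G] : Prop :=
  ∃ (n : ℕ) (N : ℕ → Subgroup G),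
    N 0 = ⊥ ∧ N n = ⊤ ∧ (∀ i, (N i).Normal) ∧
    ∀ i < n, N i ≤ N (i + 1) ∧
      ((∃ k : ℕ, (N i).relIndex (N (i + 1)) = p ^ k) ∨
        ((N i).relIndex (N (i + 1))).Coprime p)

/-- `x` is a `p`-element: its order is a power of `p`. -/
def IsPElement (p : ℕ) {G : Type*} [Group G] (x : G) : Prop :=
  ∃ k : ℕ, orderOf x = p ^ k

/-- `λ_G(x)`: the number of Sylow `p`-subgroups of `G` that contain `x`. -/
noncomputable def sylowCount (p : ℕ) {G : Type*} [Group G] (x : G) : ℕ :=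
  Nat.card {Q : Sylow p G // x ∈ Q}

/-- The set `Irr(G)` of irreducible complex characters of `G`. -/
def Irr (G : Type*) [Group G] : Set (G → ℂ) :=
  {χ | ∃ (n : ℕ) (ρ : Representation ℂ G (Fin n → ℂ)), ρ.IsIrreducible ∧ ρ.character = χ}

theorem Irr.apply_eq_of_isConj {G : Type*} [Group G] (χ : Irr G) (a b : G) (h : IsConj a b) :
    χ.1 a = χ.1 b := by
  obtain ⟨χ, n, ρ, -, rfl⟩ := χ
  obtain ⟨c, rfl⟩ := isConj_iff.1 h
  exact (ρ.char_conj a c).symm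

/-- The character table of `G`: rows are indexed by the irreducible complex characters, columns
by the conjugacy classes. -/
def characterTable (G : Type*) [Group G] (χ : Irr G) (c : ConjClasses G) : ℂ :=
  Quotient.lift χ.1 (Irr.apply_eq_of_isConj χ) c

/-- An identification of the character tables of `G` and `H`: a bijection between the rows and
a bijection between the columns that match all the entries. `G` and `H` have the same character
table if there is one. -/
structure CharacterTableIso (G H : Type*) [Group G] [Group H] where
  rows : Irr G ≃ Irr H
  cols : ConjClasses G ≃ ConjClasses H
  entry : ∀ (χ : Irr G) (c : ConjClasses G),
    characterTable H (rows χ) (cols c) = characterTable G χ c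

universe u

/-- The character table of `G` determines `|N_G(P)|`, for a Sylow `p`-subgroup `P` of `G`: in
every finite group with the same character table, the normalizers of the Sylow `p`-subgroups
have the same order. -/
def TableDeterminesNormalizer (p : ℕ) {G : Type u} [Group G] (P : Sylow p G) : Prop :=
  ∀ (H : Type u) [Group H] [Finite H], Nonempty (CharacterTableIso G H) →
    ∀ Q : Sylow p H,
      Nat.card (Subgroup.normalizer (Q : Set H)) = Nat.card (Subgroup.normalizer (P : Set G))

/-- The character table of `G` determines the value `λ_G(x)`: whenever the table of `G` is
identified with the table of a finite group `H`, the number `λ_H(y)` is `λ_G(x)` for every `y` in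
the class of `H` that corresponds to the class of `x`. -/
def TableDeterminesSylowCountAt (p : ℕ) {G : Type u} [Group G] (x : G) : Prop :=
  ∀ (H : Type u) [Group H] [Finite H] (T : CharacterTableIso G H) (y : H),
    T.cols (ConjClasses.mk x) = ConjClasses.mk y → sylowCount p y = sylowCount p x

/-- The character table of `G` determines the function `λ_G`. -/
def TableDeterminesSylowCount (p : ℕ) (G : Type u) [Group G] : Prop :=
  ∀ x : G, TableDeterminesSylowCountAt p x

/-!
Fix a Sylow `p`-subgroup `P` of `G`. Counting the `g ∈ G` with `g * x * g⁻¹ ∈ P` by the Sylow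
subgroup `g⁻¹ • P` gives `λ_G(x) * |N_G(P)|`, and `λ_G(x) ≠ 0` for a `p`-element `x`, so everything
follows once this count is read off from the character table. If `N` is a normal `p`-subgroup, then
`N ≤ P` and the count for `G` is `|N|` times the count for `G ⧸ N`. If `N` is a normal subgroup of
order prime to `p`, then the `p`-elements of `P` conjugate to `x` correspond to those of its image
conjugate to the image of `x`, so the two counts are in the ratio of the orders of the centralizers.
The table determines the normal subgroups, their orders, the tables of the quotients and the orders
of the centralizers, and `p`-solvability lets one descend to the trivial group.

The table also determines the `p`-elements: modulo a maximal ideal over `p` of the ring of algebraic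
integers, `χ(x) = χ(1)` for all `χ` exactly when `x` is a `p`-element.
-/

open Module Polynomial

section Diagonalization

variable {K V : Type*} [Field K] [AddCommGroup V] [Module K V]

theorem trace_pow_eq_sum_pow_of_hasEigenvector {ι : Type*} [Fintype ι] (b : Basis ι K V)
    {f : End K V} {μ : ι → K} (hb : ∀ i, f.HasEigenvector (μ i) (b i)) (k : ℕ) :
    LinearMap.trace K V (f ^ k) = ∑ i, μ i ^ k := by
  classical
  rw [LinearMap.trace_eq_matrix_trace K b, Matrix.trace]
  refine Finset.sum_congr rfl fun i _ => ?_
  rw [Matrix.diag_apply, LinearMap.toMatrix_apply, (hb i).pow_apply]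
  simp

theorem pow_eq_one_of_hasEigenvector {f : End K V} {μ : K} {v : V} (hv : f.HasEigenvector μ v)
    {m : ℕ} (hf : f ^ m = 1) : μ ^ m = 1 := by
  have h := hv.pow_apply m
  rw [hf, End.one_apply] at h
  exact smul_left_injective K hv.2 (by simpa using h.symm)

variable [IsAlgClosed K] [FiniteDimensional K V]

theorem exists_eigenbasis_of_squarefree_aeval_eq_zero (f : End K V) {q : K[X]}
    (hq : Squarefree q) (hf : aeval f q = 0) :
    ∃ (b : Basis (Fin (finrank K V)) K V) (μ : Fin (finrank K V) → K),
      ∀ i, f.HasEigenvector (μ i) (b i) := by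
  classical
  have hsemisimple := End.isSemisimple_of_squarefree_aeval_eq_zero hq hf
  have hinternal : DirectSum.IsInternal f.eigenspace :=
    (DirectSum.isInternal_submodule_iff_iSupIndep_and_iSup_eq_top _).2
      ⟨f.eigenspaces_iSupIndep, hsemisimple.iSup_eigenspace_eq_top⟩
  let b := hinternal.collectedBasis fun ν => finBasis K (f.eigenspace ν)
  have := Module.Finite.finite_basis b
  cases nonempty_fintype (Σ ν, Fin (finrank K (f.eigenspace ν)))
  let e := Fintype.equivFinOfCardEq (finrank_eq_card_basis b).symm
  refine ⟨b.reindex e, fun i => (e.symm i).1, fun i => ⟨?_, (b.reindex e).ne_zero i⟩⟩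
  rw [b.reindex_apply]
  exact hinternal.collectedBasis_mem _ _

theorem exists_eigenbasis_of_pow_eq_one [CharZero K] {f : End K V} {m : ℕ} (hm : m ≠ 0)
    (hf : f ^ m = 1) :
    ∃ (b : Basis (Fin (finrank K V)) K V) (μ : Fin (finrank K V) → K),
      ∀ i, f.HasEigenvector (μ i) (b i) :=
  exists_eigenbasis_of_squarefree_aeval_eq_zero f
    (X_pow_sub_one_separable_iff.2 (Nat.cast_ne_zero.2 hm)).squarefree (by simp [hf])

end Diagonalization

section Characters

variable {G V : Type*} [Group G] [AddCommGroup V] [Module ℂ V] (ρ : Representation ℂ G V)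

theorem apply_pow_orderOf (g : G) : ρ g ^ orderOf g = 1 := by
  rw [← map_pow, pow_orderOf_eq_one, map_one]

theorem pow_orderOf_eq_one_of_hasEigenvector {g : G} {μ : ℂ} {v : V}
    (hv : End.HasEigenvector (ρ g) μ v) : μ ^ orderOf g = 1 :=
  pow_eq_one_of_hasEigenvector hv (apply_pow_orderOf ρ g)

variable [Finite G]

theorem norm_eq_one_of_hasEigenvector {g : G} {μ : ℂ} {v : V}
    (hv : End.HasEigenvector (ρ g) μ v) : ‖μ‖ = 1 :=
  Complex.norm_eq_one_of_pow_eq_one (pow_orderOf_eq_one_of_hasEigenvector ρ hv) (orderOf_pos g).ne'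

theorem isIntegral_of_hasEigenvector {g : G} {μ : ℂ} {v : V}
    (hv : End.HasEigenvector (ρ g) μ v) : IsIntegral ℤ μ :=
  .of_pow (orderOf_pos g) (by
    rw [pow_orderOf_eq_one_of_hasEigenvector ρ hv]
    exact isIntegral_one)

variable [FiniteDimensional ℂ V]

theorem exists_eigenbasis_character_pow_eq_sum (g : G) :
    ∃ (b : Basis (Fin (finrank ℂ V)) ℂ V) (μ : Fin (finrank ℂ V) → ℂ),
      (∀ i, End.HasEigenvector (ρ g) (μ i) (b i)) ∧
        ∀ k : ℕ, ρ.character (g ^ k) = ∑ i, μ i ^ k := by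
  obtain ⟨b, μ, hb⟩ :=
    exists_eigenbasis_of_pow_eq_one (orderOf_pos g).ne' (apply_pow_orderOf ρ g)
  refine ⟨b, μ, hb, fun k => ?_⟩
  rw [← trace_pow_eq_sum_pow_of_hasEigenvector b hb, ← map_pow, Representation.character]

theorem character_inv_eq_conj (g : G) : ρ.character g⁻¹ = starRingEnd ℂ (ρ.character g) := by
  obtain ⟨b, μ, hb, hμ⟩ := exists_eigenbasis_character_pow_eq_sum ρ g
  have hinv : g⁻¹ = g ^ (orderOf g - 1) :=
    inv_eq_of_mul_eq_one_left (by rw [pow_sub_one_mul (orderOf_pos g).ne', pow_orderOf_eq_one])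
  have hsum : ρ.character g = ∑ i, μ i := by simpa using hμ 1
  rw [hinv, hμ, hsum, map_sum]
  refine Finset.sum_congr rfl fun i _ => ?_
  rw [← Complex.inv_eq_conj (norm_eq_one_of_hasEigenvector ρ (hb i))]
  refine eq_inv_of_mul_eq_one_left ?_
  rw [pow_sub_one_mul (orderOf_pos g).ne', pow_orderOf_eq_one_of_hasEigenvector ρ (hb i)]

open scoped ComplexOrder in
theorem apply_eq_one_of_character_eq {g : G} (hg : ρ.character g = ρ.character 1) : ρ g = 1 := by
  obtain ⟨b, μ, hb, hμ⟩ := exists_eigenbasis_character_pow_eq_sum ρ g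
  have hnorm := fun i => norm_eq_one_of_hasEigenvector ρ (hb i)
  have hsum : ∑ i, (μ i).re = ∑ _i : Fin (finrank ℂ V), (1 : ℝ) := by
    have h1 : ρ.character g = ∑ i, μ i := by simpa using hμ 1
    simpa using congrArg Complex.re (h1.symm.trans hg)
  have hre := (Finset.sum_eq_sum_iff_of_le fun i _ =>
    (Complex.re_le_norm _).trans (hnorm i).le).1 hsum
  refine b.ext fun i => ?_
  have hpos : 0 ≤ μ i := Complex.re_eq_norm.1 ((hre i (Finset.mem_univ i)).trans (hnorm i).symm)
  have hone : μ i = 1 := by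
    rw [Complex.eq_coe_norm_of_nonneg hpos, hnorm i, Complex.ofReal_one]
  rw [(hb i).apply_eq_smul, hone, one_smul, End.one_apply]

end Characters

section Irreducible

variable {K G H V W : Type*} [Field K] [AddCommGroup V] [Module K V] [AddCommGroup W] [Module K W]

/-- The isomorphism of lattices of subrepresentations induced by a linear equivalence that is
equivariant along a surjective homomorphism `f`. -/
def subrepresentationOrderIso [Monoid G] [Monoid H] {ρ : Representation K G V}
    {σ : Representation K H W} (e : V ≃ₗ[K] W) {f : G →* H} (hf : Function.Surjective f)
    (he : ∀ g v, e (ρ g v) = σ (f g) (e v)) : Subrepresentation ρ ≃o Subrepresentation σ where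
  toFun U := ⟨U.toSubmodule.map e.toLinearMap, by
    rintro h _ ⟨v, hv, rfl⟩
    obtain ⟨g, rfl⟩ := hf h
    exact ⟨ρ g v, U.apply_mem_toSubmodule g hv, he g v⟩⟩
  invFun U := ⟨U.toSubmodule.comap e.toLinearMap, fun g v hv => by
    rw [Submodule.mem_comap, LinearEquiv.coe_coe, he]
    exact U.apply_mem_toSubmodule (f g) hv⟩
  left_inv U := Subrepresentation.toSubmodule_injective
    (Submodule.comap_map_eq_of_injective e.injective _)
  right_inv U := Subrepresentation.toSubmodule_injective
    (Submodule.map_comap_eq_of_surjective e.surjective _)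
  map_rel_iff' := Submodule.map_le_map_iff_of_injective e.injective _ _

theorem isIrreducible_iff_of_linearEquiv [Monoid G] [Monoid H] {ρ : Representation K G V}
    {σ : Representation K H W} (e : V ≃ₗ[K] W) {f : G →* H} (hf : Function.Surjective f)
    (he : ∀ g v, e (ρ g v) = σ (f g) (e v)) : ρ.IsIrreducible ↔ σ.IsIrreducible :=
  (subrepresentationOrderIso e hf he).isSimpleOrder_iff

theorem nontrivial_of_isIrreducible [Monoid G] {ρ : Representation K G V} (hρ : ρ.IsIrreducible) :
    Nontrivial V := by
  by_contra hV
  rw [not_nontrivial_iff_subsingleton] at hV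
  exact bot_ne_top (α := Subrepresentation ρ)
    (Subrepresentation.toSubmodule_injective (Subsingleton.elim _ _))

theorem eq_zero_of_commute_of_trace_eq_zero [IsAlgClosed K] [CharZero K] [FiniteDimensional K V]
    [Monoid G] {ρ : Representation K G V} (hρ : ρ.IsIrreducible) {F : End K V}
    (hF : ∀ g, Commute F (ρ g)) (htr : LinearMap.trace K V F = 0) : F = 0 := by
  obtain ⟨c, hc⟩ :=
    (Representation.IsIrreducible.algebraMap_intertwiningMap_bijective_of_isAlgClosed).2
      (⟨F, hF⟩ : Representation.IntertwiningMap ρ ρ)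
  have hscalar : c • (LinearMap.id : V →ₗ[K] V) = F :=
    congrArg Representation.IntertwiningMap.toLinearMap hc
  have := nontrivial_of_isIrreducible hρ
  have hdim : (finrank K V : K) ≠ 0 := Nat.cast_ne_zero.2 finrank_pos.ne'
  rw [← hscalar, map_smul, LinearMap.trace_id, smul_eq_mul] at htr
  rw [← hscalar, (mul_eq_zero.1 htr).resolve_right hdim, zero_smul]

section OfModule

open scoped MonoidAlgebra

variable (M : Type*) [Group G] [AddCommGroup M] [Module K M] [Module K[G] M]
  [IsScalarTower K K[G] M]

theorem asAlgebraHom_ofModule'_apply (a : K[G]) (m : M) :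
    (Representation.ofModule' M : Representation K G M).asAlgebraHom a m = a • m := by
  simp [Representation.asAlgebraHom, Representation.ofModule']

theorem isIrreducible_ofModule' [IsSimpleModule K[G] M] :
    (Representation.ofModule' M : Representation K G M).IsIrreducible := by
  rw [Representation.irreducible_iff_isSimpleModule_asModule]
  let σ : Representation K G M := Representation.ofModule' M
  let e : σ.asModule ≃ₗ[K[G]] M :=
    { σ.asModuleEquiv.toAddEquiv with
      map_smul' a m := (σ.asModuleEquiv_map_smul a m).trans (asAlgebraHom_ofModule'_apply M a _) }
  exact IsSimpleModule.congr e

end OfModule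

end Irreducible

section Irr

variable {G : Type*} [Group G]

theorem eq_zero_of_forall_isMaximal_smul_eq_zero {R : Type*} [Ring R] [IsSemisimpleRing R] {z : R}
    (hz : ∀ I : Ideal R, I.IsMaximal → ∀ m : R ⧸ I, z • m = 0) : z = 0 := by
  have hjacobson : z ∈ Ring.jacobson R := by
    rw [Ring.jacobson_eq_sInf_isMaximal, Submodule.mem_sInf]
    intro I hI
    rw [← Submodule.Quotient.mk_eq_zero I, ← mul_one z, ← smul_eq_mul]
    exact hz I hI (Submodule.Quotient.mk 1)
  rwa [Ring.jacobson, IsSemisimpleModule.jacobson_eq_bot] at hjacobson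

theorem card_centralizer_singleton_one :
    Nat.card (Subgroup.centralizer {(1 : G)}) = Nat.card G := by
  rw [Subgroup.centralizer_eq_top_iff_subset.2 (Set.singleton_subset_iff.2 (one_mem _)),
    Subgroup.card_top]

namespace Irr

theorem character_mem {V : Type*} [AddCommGroup V] [Module ℂ V] [FiniteDimensional ℂ V]
    {ρ : Representation ℂ G V} (hρ : ρ.IsIrreducible) : ρ.character ∈ Irr G := by
  let e : V ≃ₗ[ℂ] (Fin (finrank ℂ V) → ℂ) := (finBasis ℂ V).equivFun
  let σ : Representation ℂ G (Fin (finrank ℂ V) → ℂ) :=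
    (e.conjAlgEquiv ℂ).toAlgHom.toMonoidHom.comp ρ
  refine ⟨_, σ, (isIrreducible_iff_of_linearEquiv (σ := σ) e (f := .id G)
    Function.surjective_id fun g v => ?_).1 hρ, funext fun g => LinearMap.trace_conj' (ρ g) e⟩
  simp [σ]

theorem apply_conj (χ : Irr G) (a t : G) : χ.1 (t * a * t⁻¹) = χ.1 a :=
  (apply_eq_of_isConj χ a _ (isConj_iff.2 ⟨t, rfl⟩)).symm

section ClassFunction

open scoped MonoidAlgebra

variable [Fintype G] {f : G → ℂ}

theorem sum_single_smul_eq_zero {M : Type*} [AddCommGroup M] [Module ℂ M] [Module ℂ[G] M]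
    [IsScalarTower ℂ ℂ[G] M] [IsSimpleModule ℂ[G] M] (hf : ∀ a t, f (t * a * t⁻¹) = f a)
    (horth : ∀ χ : Irr G, ∑ g, f g * χ.1 g = 0) (m : M) :
    (∑ g, MonoidAlgebra.single g (f g) : ℂ[G]) • m = 0 := by
  let z : ℂ[G] := ∑ g, MonoidAlgebra.single g (f g)
  have hcomm (h : G) : Commute z (MonoidAlgebra.single h 1) := by
    simp only [z, Commute, SemiconjBy, Finset.sum_mul, Finset.mul_sum,
      MonoidAlgebra.single_mul_single, mul_one, one_mul]
    rw [← Equiv.sum_comp (MulAut.conj h).toEquiv]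
    simp [hf]
  have : FiniteDimensional ℂ M := Module.Finite.trans ℂ[G] M
  let σ : Representation ℂ G M := Representation.ofModule' M
  have hzσ : σ.asAlgebraHom z = 0 := by
    refine eq_zero_of_commute_of_trace_eq_zero (isIrreducible_ofModule' (G := G) M) (fun h => ?_) ?_
    · rw [← σ.asAlgebraHom_single_one]
      exact (hcomm h).map σ.asAlgebraHom
    · simpa [z, Representation.character] using
        horth ⟨_, character_mem (isIrreducible_ofModule' (G := G) M)⟩
  rw [← asAlgebraHom_ofModule'_apply]
  exact LinearMap.congr_fun hzσ m

theorem eq_zero_of_forall_sum_mul_eq_zero (hf : ∀ a t, f (t * a * t⁻¹) = f a)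
    (horth : ∀ χ : Irr G, ∑ g, f g * χ.1 g = 0) : f = 0 := by
  have hz : (∑ g, MonoidAlgebra.single g (f g) : ℂ[G]) = 0 :=
    eq_zero_of_forall_isMaximal_smul_eq_zero fun I hI m =>
      have : IsSimpleModule ℂ[G] (ℂ[G] ⧸ I) := isSimpleModule_iff_isCoatom.2 hI.out
      sum_single_smul_eq_zero hf horth m
  ext g
  classical
  simpa [Finsupp.single_apply] using congrArg (fun a : ℂ[G] => a.coeff g) hz

end ClassFunction

theorem sum_mul_inv [Fintype G] [DecidableEq (Irr G)] (χ ψ : Irr G) :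
    ∑ g, χ.1 g * ψ.1 g⁻¹ = if χ = ψ then (Nat.card G : ℂ) else 0 := by
  have hcard : (Nat.card G : ℂ) ≠ 0 := Nat.cast_ne_zero.2 Nat.card_pos.ne'
  obtain ⟨_, n, ρ, hρ, rfl⟩ := χ
  obtain ⟨_, m, σ, hσ, rfl⟩ := ψ
  have horth := Representation.char_orthonormal ρ σ
  split_ifs with h
  · have h2 := Representation.char_orthonormal ρ ρ
    rw [if_pos ⟨Representation.Equiv.refl ρ⟩] at h2
    have h' : ρ.character = σ.character := congrArg Subtype.val h
    rw [inv_mul_eq_one₀ hcard] at h2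
    simpa only [← h'] using h2.symm
  · rw [if_neg] at horth
    · simpa [hcard] using horth
    · rintro ⟨e⟩
      exact h (Subtype.ext (Representation.char_iso e).symm)

theorem linearIndependent [Finite G] : LinearIndependent ℂ fun χ : Irr G => χ.1 := by
  classical
  cases nonempty_fintype G
  refine linearIndependent_iff'.2 fun s c hs ψ hψ => ?_
  have h : ∑ g, (∑ χ ∈ s, c χ • χ.1) g * ψ.1 g⁻¹ = 0 := by rw [hs]; simp
  simp only [Finset.sum_apply, Pi.smul_apply, smul_eq_mul, Finset.sum_mul] at h
  rw [Finset.sum_comm] at h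
  simp only [mul_assoc, ← Finset.mul_sum, sum_mul_inv] at h
  simpa [hψ] using h

instance [Finite G] : Finite (Irr G) := linearIndependent.finite

noncomputable instance [Finite G] : Fintype (Irr G) := Fintype.ofFinite _

theorem sum_mul_apply_inv [Finite G] (x g : G) :
    ∑ χ : Irr G, χ.1 x * χ.1 g⁻¹ = Nat.card {t : G // t * x * t⁻¹ = g} := by
  classical
  cases nonempty_fintype G
  let f : G → ℂ := fun g =>
    (∑ t : G, if t * x * t⁻¹ = g then 1 else 0) - ∑ χ : Irr G, χ.1 x * χ.1 g⁻¹
  have hclass (a s : G) : f (s * a * s⁻¹) = f a := by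
    simp only [f, conj_inv, apply_conj]
    congr 1
    rw [← Equiv.sum_comp (Equiv.mulLeft s)]
    refine Finset.sum_congr rfl fun t _ => if_congr ?_ rfl rfl
    rw [Equiv.coe_mulLeft, mul_inv_rev, ← mul_left_inj s, ← mul_right_inj s⁻¹]
    simp only [mul_assoc, inv_mul_cancel_left, inv_mul_cancel, mul_one]
  have horth (ψ : Irr G) : ∑ g, f g * ψ.1 g = 0 := by
    simp only [f, sub_mul, Finset.sum_sub_distrib, Finset.sum_mul, ite_mul, one_mul, zero_mul]
    rw [Finset.sum_comm, Finset.sum_comm (t := (Finset.univ : Finset (Irr G)))]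
    have hchar (χ : Irr G) : ∑ a, χ.1 x * χ.1 a⁻¹ * ψ.1 a =
        χ.1 x * if ψ = χ then (Nat.card G : ℂ) else 0 := by
      rw [← sum_mul_inv, Finset.mul_sum]
      exact Finset.sum_congr rfl fun a _ => by ring
    simp only [hchar]
    simp [apply_conj, mul_comm]
  have hf := congrFun (eq_zero_of_forall_sum_mul_eq_zero hclass horth) g
  rw [Nat.card_eq_fintype_card, Fintype.card_subtype, ← Finset.sum_boole]
  exact (sub_eq_zero.1 hf).symm

open scoped ComplexOrder in
theorem apply_one_pos (χ : Irr G) : 0 < χ.1 1 := by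
  obtain ⟨_, n, ρ, hρ, rfl⟩ := χ
  have := nontrivial_of_isIrreducible hρ
  change 0 < ρ.character 1
  rw [ρ.char_one, ← Nat.cast_zero, Nat.cast_lt]
  exact finrank_pos

variable [Finite G]

theorem apply_inv (χ : Irr G) (g : G) : χ.1 g⁻¹ = starRingEnd ℂ (χ.1 g) := by
  obtain ⟨_, n, ρ, -, rfl⟩ := χ
  exact character_inv_eq_conj ρ g

theorem isConj_iff_sum_mul_apply_inv_ne_zero (a b : G) :
    IsConj a b ↔ ∑ χ : Irr G, χ.1 a * χ.1 b⁻¹ ≠ 0 := by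
  rw [sum_mul_apply_inv, Nat.cast_ne_zero, ← Nat.pos_iff_ne_zero, Finite.card_pos_iff,
    nonempty_subtype, isConj_iff]

theorem card_centralizer_eq_sum (x : G) :
    (Nat.card (Subgroup.centralizer {x}) : ℂ) = ∑ χ : Irr G, χ.1 x * χ.1 x⁻¹ := by
  rw [sum_mul_apply_inv]
  congr 1
  refine Nat.card_congr (Equiv.subtypeEquivRight fun t => ?_)
  rw [Subgroup.mem_centralizer_singleton_iff, mul_inv_eq_iff_eq_mul]

theorem isConj_iff_forall_apply_eq {a b : G} : IsConj a b ↔ ∀ χ : Irr G, χ.1 a = χ.1 b := by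
  refine ⟨fun h χ => apply_eq_of_isConj χ a b h, fun h => ?_⟩
  rw [isConj_iff_sum_mul_apply_inv_ne_zero]
  simp only [apply_inv, ← h]
  simpa only [apply_inv] using (isConj_iff_sum_mul_apply_inv_ne_zero a a).1 (IsConj.refl a)

theorem apply_mul_of_apply_eq {χ : Irr G} {a : G} (ha : χ.1 a = χ.1 1) (b : G) :
    χ.1 (a * b) = χ.1 b := by
  obtain ⟨n, ρ, -, hρ⟩ := χ.2
  rw [← hρ] at ha ⊢
  simp only [Representation.character, map_mul, apply_eq_one_of_character_eq ρ ha, one_mul]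

/-- The kernel of an irreducible character: the elements at which it takes its value at `1`. It is
the kernel of any representation that affords the character. -/
def ker (χ : Irr G) : Subgroup G where
  carrier := {g | χ.1 g = χ.1 1}
  one_mem' := rfl
  mul_mem' ha hb := (apply_mul_of_apply_eq ha _).trans hb
  inv_mem' {a} ha := by
    rw [Set.mem_ofPred_eq, ← apply_mul_of_apply_eq ha, mul_inv_cancel]

theorem mem_ker {χ : Irr G} {g : G} : g ∈ ker χ ↔ χ.1 g = χ.1 1 := Iff.rfl

instance (χ : Irr G) : (ker χ).Normal := ⟨fun _ ha t => (apply_conj χ _ t).trans ha⟩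

/-- Inflation identifies the irreducible characters of `G ⧸ N` with the irreducible characters of
`G` whose kernel contains `N`. -/
noncomputable def quotientEquiv (N : Subgroup G) [N.Normal] :
    Irr (G ⧸ N) ≃ {χ : Irr G // N ≤ ker χ} :=
  Equiv.ofBijective
    (fun χ => ⟨⟨fun g => χ.1 g, by
        obtain ⟨_, n, ρ, hρ, rfl⟩ := χ
        exact ⟨n, ρ.comp (QuotientGroup.mk' N), (isIrreducible_iff_of_linearEquiv
          (.refl ℂ _) (QuotientGroup.mk'_surjective N) fun _ _ => rfl).2 hρ, rfl⟩⟩,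
      fun n hn => congrArg χ.1 ((QuotientGroup.eq_one_iff n).2 hn)⟩)
    (by
      constructor
      · intro χ ψ h
        ext a
        obtain ⟨g, rfl⟩ := QuotientGroup.mk_surjective a
        exact congrFun (congrArg (fun η => η.1.1) h) g
      · rintro ⟨⟨_, n, ρ, hρ, rfl⟩, hχ⟩
        let σ : Representation ℂ (G ⧸ N) (Fin n → ℂ) :=
          QuotientGroup.lift N ρ fun a ha => apply_eq_one_of_character_eq ρ (hχ ha)
        exact ⟨⟨σ.character, n, σ, (isIrreducible_iff_of_linearEquiv (.refl ℂ _)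
          (QuotientGroup.mk'_surjective N) fun _ _ => rfl).1 hρ, rfl⟩, rfl⟩)

theorem quotientEquiv_apply (N : Subgroup G) [N.Normal] (χ : Irr (G ⧸ N)) (g : G) :
    (quotientEquiv N χ).1.1 g = χ.1 g := rfl

end Irr

end Irr

namespace CharacterTableIso

variable {G H : Type*} [Group G] [Group H] (T : CharacterTableIso G H)

theorem apply_eq {x : G} {y : H} (h : T.cols (.mk x) = .mk y) (χ : Irr G) :
    (T.rows χ).1 y = χ.1 x := by
  have hentry := T.entry χ (.mk x)
  rw [h] at hentry
  exact hentry

theorem exists_cols_mk_eq (x : G) : ∃ y, T.cols (.mk x) = .mk y :=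
  (ConjClasses.exists_rep (T.cols (.mk x))).imp fun _ => Eq.symm

theorem exists_cols_mk_eq_mk (y : H) : ∃ x, T.cols (.mk x) = .mk y :=
  (ConjClasses.exists_rep (T.cols.symm (.mk y))).imp fun _ h => (Equiv.eq_symm_apply _).1 h

theorem cols_mk_eq_iff [Finite H] {x : G} {y : H} :
    T.cols (.mk x) = .mk y ↔ ∀ χ, (T.rows χ).1 y = χ.1 x := by
  refine ⟨T.apply_eq, fun h => ?_⟩
  obtain ⟨z, hz⟩ := T.exists_cols_mk_eq x
  rw [hz, ConjClasses.mk_eq_mk_iff_isConj, Irr.isConj_iff_forall_apply_eq]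
  intro ψ
  obtain ⟨χ, rfl⟩ := T.rows.surjective ψ
  rw [T.apply_eq hz, h]

theorem characterTable_injective [Finite G] :
    Function.Injective fun (c : ConjClasses G) (χ : Irr G) => characterTable G χ c := by
  intro c d h
  obtain ⟨x, rfl⟩ := ConjClasses.mk_surjective c
  obtain ⟨y, rfl⟩ := ConjClasses.mk_surjective d
  exact ConjClasses.mk_eq_mk_iff_isConj.2 (Irr.isConj_iff_forall_apply_eq.2 (congrFun h))

/-- The identification of character tables determined by a bijection of the rows under which the
two tables have the same columns. -/
noncomputable def ofRows [Finite G] [Finite H] (e : Irr G ≃ Irr H)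
    (hG : ∀ c, ∃ d, ∀ χ, characterTable H (e χ) d = characterTable G χ c)
    (hH : ∀ d, ∃ c, ∀ χ, characterTable H (e χ) d = characterTable G χ c) :
    CharacterTableIso G H where
  rows := e
  cols := Equiv.ofBijective (fun c => (hG c).choose) <| by
    refine ⟨fun c d h => characterTable_injective (funext fun χ => ?_), fun d => ?_⟩
    · change characterTable G χ c = characterTable G χ d
      rw [← (hG c).choose_spec χ, ← (hG d).choose_spec χ]
      exact congrArg _ h
    · obtain ⟨c, hc⟩ := hH d
      refine ⟨c, characterTable_injective (funext fun ψ => ?_)⟩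
      obtain ⟨χ, rfl⟩ := e.surjective ψ
      exact ((hG c).choose_spec χ).trans (hc χ).symm
  entry χ c := (hG c).choose_spec χ

variable [Finite G]

theorem cols_mk_one : T.cols (.mk 1) = .mk 1 := by
  open scoped ComplexOrder in
  obtain ⟨x, hx⟩ := T.exists_cols_mk_eq_mk 1
  suffices IsConj x 1 by rwa [isConj_one_left.1 this] at hx
  rw [Irr.isConj_iff_sum_mul_apply_inv_ne_zero]
  have hne : (Finset.univ : Finset (Irr G)).Nonempty :=
    Finset.nonempty_of_sum_ne_zero ((Irr.isConj_iff_sum_mul_apply_inv_ne_zero 1 1).1 (.refl 1))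
  refine (Finset.sum_pos (fun χ _ => ?_) hne).ne'
  rw [inv_one, ← T.apply_eq hx]
  exact mul_pos (Irr.apply_one_pos _) (Irr.apply_one_pos _)

theorem rows_apply_one (χ : Irr G) : (T.rows χ).1 1 = χ.1 1 :=
  T.apply_eq T.cols_mk_one χ

variable [Finite H]

theorem card_centralizer_eq {x : G} {y : H} (h : T.cols (.mk x) = .mk y) :
    Nat.card (Subgroup.centralizer {x}) = Nat.card (Subgroup.centralizer {y}) := by
  rw [← Nat.cast_inj (R := ℂ), Irr.card_centralizer_eq_sum, Irr.card_centralizer_eq_sum,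
    ← T.rows.sum_comp]
  simp only [Irr.apply_inv, T.apply_eq h]

include T in
theorem card_eq : Nat.card G = Nat.card H := by
  simpa only [card_centralizer_singleton_one] using T.card_centralizer_eq T.cols_mk_one

/-- The normal subgroup of `H` that corresponds to a normal subgroup `N` of `G`: the intersection
of the kernels of the characters that correspond to those with kernel containing `N`. -/
def normalMap (N : Subgroup G) : Subgroup H :=
  ⨅ χ : {χ : Irr G // N ≤ Irr.ker χ}, Irr.ker (T.rows χ)

instance (N : Subgroup G) : (T.normalMap N).Normal :=
  Subgroup.normal_iInf_normal fun _ => inferInstance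

theorem mem_ker_rows_iff {x : G} {y : H} (h : T.cols (.mk x) = .mk y) (χ : Irr G) :
    y ∈ Irr.ker (T.rows χ) ↔ x ∈ Irr.ker χ := by
  rw [Irr.mem_ker, Irr.mem_ker, T.apply_eq h, T.rows_apply_one]

theorem normalMap_le_ker_iff (N : Subgroup G) (χ : Irr G) :
    N ≤ Irr.ker χ ↔ T.normalMap N ≤ Irr.ker (T.rows χ) := by
  refine ⟨fun h => iInf_le_of_le ⟨χ, h⟩ le_rfl, fun h x hx => ?_⟩
  obtain ⟨y, hy⟩ := T.exists_cols_mk_eq x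
  rw [← T.mem_ker_rows_iff hy]
  exact h (Subgroup.mem_iInf.2 fun ψ => (T.mem_ker_rows_iff hy _).2 (ψ.2 hx))

/-- The bijection between the characters of the quotients by corresponding normal subgroups. -/
noncomputable def quotientRows (N : Subgroup G) [N.Normal] :
    Irr (G ⧸ N) ≃ Irr (H ⧸ T.normalMap N) :=
  (Irr.quotientEquiv N).trans
    ((T.rows.subtypeEquiv (T.normalMap_le_ker_iff N)).trans (Irr.quotientEquiv _).symm)

variable (N : Subgroup G) [N.Normal]

theorem quotientRows_apply {x : G} {y : H} (h : T.cols (.mk x) = .mk y) (χ : Irr (G ⧸ N)) :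
    (T.quotientRows N χ).1 y = χ.1 x := by
  rw [← Irr.quotientEquiv_apply (T.normalMap N), quotientRows]
  simp only [Equiv.trans_apply, Equiv.apply_symm_apply, Equiv.subtypeEquiv_apply]
  rw [T.apply_eq h, Irr.quotientEquiv_apply]

/-- The identification of the character tables of the quotients by corresponding normal
subgroups. -/
noncomputable def quotient : CharacterTableIso (G ⧸ N) (H ⧸ T.normalMap N) :=
  ofRows (T.quotientRows N)
    (fun c => by
      obtain ⟨a, rfl⟩ := ConjClasses.mk_surjective c
      obtain ⟨x, rfl⟩ := QuotientGroup.mk_surjective a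
      obtain ⟨y, h⟩ := T.exists_cols_mk_eq x
      exact ⟨.mk y, T.quotientRows_apply N h⟩)
    (fun d => by
      obtain ⟨b, rfl⟩ := ConjClasses.mk_surjective d
      obtain ⟨y, rfl⟩ := QuotientGroup.mk_surjective b
      obtain ⟨x, h⟩ := T.exists_cols_mk_eq_mk y
      exact ⟨.mk x, T.quotientRows_apply N h⟩)

theorem quotient_cols_mk {x : G} {y : H} (h : T.cols (.mk x) = .mk y) :
    (T.quotient N).cols (.mk (x : G ⧸ N)) = .mk (y : H ⧸ T.normalMap N) :=
  (T.quotient N).cols_mk_eq_iff.2 (T.quotientRows_apply N h)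

theorem card_normalMap : Nat.card (T.normalMap N) = Nat.card N := by
  have h := (T.normalMap N).card_eq_card_quotient_mul_card_subgroup
  rw [← T.card_eq, ← (T.quotient N).card_eq, N.card_eq_card_quotient_mul_card_subgroup] at h
  exact (Nat.eq_of_mul_eq_mul_left Nat.card_pos h).symm

end CharacterTableIso

theorem exists_ringHom_integralClosure_charP (p : ℕ) [Fact p.Prime] :
    ∃ (k : Type) (_ : Field k) (_ : CharP k p), Nonempty (integralClosure ℤ ℂ →+* k) := by
  have hp : p.Prime := Fact.out
  have : (Ideal.span {(p : ℤ)}).IsMaximal :=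
    PrincipalIdealRing.isMaximal_of_irreducible (Nat.prime_iff_prime_int.1 hp).irreducible
  have hker : RingHom.ker (algebraMap ℤ (integralClosure ℤ ℂ)) ≤ Ideal.span {(p : ℤ)} := by
    rw [(RingHom.injective_iff_ker_eq_bot _).1 (algebraMap ℤ (integralClosure ℤ ℂ)).injective_int]
    exact bot_le
  obtain ⟨M, hM, hcomap⟩ := Ideal.exists_ideal_over_maximal_of_isIntegral _ hker
  refine ⟨_ ⧸ M, Ideal.Quotient.field M, ?_, ⟨Ideal.Quotient.mk M⟩⟩
  rw [CharP.charP_iff_prime_eq_zero hp, ← map_natCast (Ideal.Quotient.mk M),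
    Ideal.Quotient.eq_zero_iff_mem, ← map_natCast (algebraMap ℤ (integralClosure ℤ ℂ)),
    ← Ideal.mem_comap, hcomap]
  exact Ideal.mem_span_singleton_self _

section PElement

variable {G : Type*} [Group G]

theorem isPElement_conj_iff {p : ℕ} {g x : G} : IsPElement p (g * x * g⁻¹) ↔ IsPElement p x := by
  simp only [IsPElement, ← MulAut.conj_apply, MulEquiv.orderOf_eq]

theorem IsPElement.of_mem {p : ℕ} [Fact p.Prime] {P : Subgroup G} (hP : IsPGroup p P) {x : G}
    (hx : x ∈ P) : IsPElement p x := by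
  obtain ⟨j, hj⟩ := hP.exists_orderOf_eq_pow ⟨x, hx⟩
  exact ⟨j, by rw [← hj, Subgroup.orderOf_mk]⟩

/-- The number of elements of `G` that conjugate `x` into `P`. -/
noncomputable def transporterCard (P : Subgroup G) (x : G) : ℕ :=
  Nat.card {g : G // g * x * g⁻¹ ∈ P}

theorem transporterCard_one (P : Subgroup G) : transporterCard P 1 = Nat.card G :=
  Nat.card_congr (Equiv.subtypeUnivEquiv fun g => by simp)

variable [Finite G]

namespace Irr

theorem isIntegral_apply (χ : Irr G) (g : G) : IsIntegral ℤ (χ.1 g) := by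
  obtain ⟨_, n, ρ, -, rfl⟩ := χ
  obtain ⟨b, μ, hb, hμ⟩ := exists_eigenbasis_character_pow_eq_sum ρ g
  change IsIntegral ℤ (ρ.character g)
  rw [← pow_one g, hμ]
  exact IsIntegral.sum _ fun i _ => (isIntegral_of_hasEigenvector ρ (hb i)).pow 1

/-- The value of an irreducible character, as an algebraic integer. -/
noncomputable def value (χ : Irr G) (g : G) : integralClosure ℤ ℂ :=
  ⟨χ.1 g, isIntegral_apply χ g⟩

theorem exists_value_pow_eq_sum (χ : Irr G) (g : G) :
    ∃ (n : ℕ) (μ : Fin n → integralClosure ℤ ℂ), ∀ k, value χ (g ^ k) = ∑ i, μ i ^ k := by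
  obtain ⟨_, n, ρ, hρ, rfl⟩ := χ
  obtain ⟨b, μ, hb, hμ⟩ := exists_eigenbasis_character_pow_eq_sum ρ g
  refine ⟨_, fun i => ⟨μ i, isIntegral_of_hasEigenvector ρ (hb i)⟩, fun k => Subtype.ext ?_⟩
  change ρ.character (g ^ k) = _
  rw [hμ k]
  push_cast
  rfl

theorem exists_sum_subgroup_eq_card_mul (χ : Irr G) (P : Subgroup G) [Fintype P] :
    ∃ m : ℕ, ∑ g : P, χ.1 g = Nat.card P * m := by
  obtain ⟨_, n, ρ, -, rfl⟩ := χ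
  refine ⟨finrank ℂ (Representation.invariants (ρ.comp P.subtype)), ?_⟩
  rw [← Representation.card_inv_mul_sum_char_eq_finrank,
    mul_inv_cancel_left₀ (Nat.cast_ne_zero.2 Nat.card_pos.ne')]
  rfl

/-- The class function `∑ χ, m χ * χ` is the permutation character of `G` on `G ⧸ P`. By Frobenius
reciprocity, the multiplicity `m χ` is the dimension of the `P`-invariants. -/
theorem exists_transporterCard_eq_card_mul_sum (P : Subgroup G) :
    ∃ m : Irr G → ℕ, ∀ x, (transporterCard P x : ℂ) = Nat.card P * ∑ χ, m χ * χ.1 x := by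
  cases nonempty_fintype P
  choose m hm using fun χ : Irr G => exists_sum_subgroup_eq_card_mul χ P
  refine ⟨m, fun x => ?_⟩
  simp only [Finset.mul_sum, ← mul_assoc, ← hm, Finset.sum_mul]
  rw [Finset.sum_comm, ← Equiv.sum_comp (Equiv.inv P)]
  simp only [Equiv.inv_apply, Subgroup.coe_inv, mul_comm, sum_mul_apply_inv]
  rw [← Nat.cast_sum, ← Nat.card_sigma, Nat.cast_inj]
  exact (Nat.card_congr (Equiv.sigmaSubtypeFiberEquivSubtype (q := (· ∈ P))
    (fun g : G => g * x * g⁻¹) fun _ => Iff.rfl)).symm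

end Irr

section Reduction

variable {p : ℕ} [Fact p.Prime] {k : Type*} [Field k] [CharP k p] (φ : integralClosure ℤ ℂ →+* k)

theorem Irr.map_value_pow_prime_pow (χ : Irr G) (g : G) (j : ℕ) :
    φ (value χ (g ^ p ^ j)) = φ (value χ g) ^ p ^ j := by
  obtain ⟨n, μ, hμ⟩ := exists_value_pow_eq_sum χ g
  have hg : value χ g = ∑ i, μ i := by simpa using hμ 1
  rw [hμ, hg, map_sum, map_sum, sum_pow_char_pow]
  simp only [map_pow]

/-- If no conjugate of `x` lies in a Sylow `p`-subgroup `P`, then the permutation character of `G`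
on `G ⧸ P` vanishes at `x`; but its value at `1` is the index of `P`, which is prime to `p`. -/
theorem isPElement_of_forall_map_value_eq {x : G}
    (hx : ∀ χ : Irr G, φ (Irr.value χ x) = φ (Irr.value χ 1)) : IsPElement p x := by
  let P : Sylow p G := default
  obtain ⟨m, hm⟩ := Irr.exists_transporterCard_eq_card_mul_sum P.toSubgroup
  let π (g : G) : integralClosure ℤ ℂ := ∑ χ, m χ * Irr.value χ g
  have hπ (g : G) : (π g : ℂ) = ∑ χ, m χ * χ.1 g := by
    simp only [π]
    push_cast
    rfl
  have hcard : (Nat.card P : ℂ) ≠ 0 := Nat.cast_ne_zero.2 Nat.card_pos.ne'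
  have hone : π 1 = P.index := Subtype.ext <| mul_left_cancel₀ hcard <| by
    rw [hπ, ← hm, transporterCard_one, ← P.card_mul_index]
    push_cast
    rfl
  have hne : φ (π x) ≠ 0 := by
    have : φ (π x) = φ (π 1) := by simp only [π, map_sum, map_mul, hx]
    rw [this, hone, map_natCast, Ne, CharP.cast_eq_zero_iff k p]
    exact P.not_dvd_index
  have htransporter : transporterCard P.toSubgroup x ≠ 0 := fun h => hne <| by
    have hx := hm x
    rw [h, Nat.cast_zero, ← hπ, zero_eq_mul] at hx
    rw [show π x = 0 from Subtype.ext (hx.resolve_left hcard), map_zero]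
  obtain ⟨⟨g, hg⟩⟩ := (Nat.card_ne_zero.1 htransporter).1
  exact isPElement_conj_iff.1 (.of_mem P.2 hg)

theorem isPElement_iff_forall_map_value_eq {x : G} :
    IsPElement p x ↔ ∀ χ : Irr G, φ (Irr.value χ x) = φ (Irr.value χ 1) := by
  refine ⟨fun ⟨j, hj⟩ χ => iterateFrobenius_inj k p j ?_, isPElement_of_forall_map_value_eq φ⟩
  rw [iterateFrobenius_def, iterateFrobenius_def, ← Irr.map_value_pow_prime_pow,
    ← Irr.map_value_pow_prime_pow, ← hj, pow_orderOf_eq_one, one_pow]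

end Reduction

end PElement

theorem CharacterTableIso.isPElement_iff {G H : Type*} [Group G] [Group H] [Finite G] [Finite H]
    (T : CharacterTableIso G H) (p : ℕ) [Fact p.Prime] {x : G} {y : H}
    (h : T.cols (.mk x) = .mk y) : IsPElement p x ↔ IsPElement p y := by
  obtain ⟨k, _, _, ⟨φ⟩⟩ := exists_ringHom_integralClosure_charP p
  rw [isPElement_iff_forall_map_value_eq φ, isPElement_iff_forall_map_value_eq φ,
    ← T.rows.forall_congr_right]
  have hx (χ : Irr G) : Irr.value (T.rows χ) y = Irr.value χ x := Subtype.ext (T.apply_eq h χ)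
  have hone (χ : Irr G) : Irr.value (T.rows χ) 1 = Irr.value χ 1 :=
    Subtype.ext (T.rows_apply_one χ)
  simp only [hx, hone]

section Transporter

variable {G : Type*} [Group G]

theorem card_smul_mem_eq_mul_card_stabilizer {X : Type*} [MulAction G X] (S : Set X) (a : X) :
    Nat.card {g : G // g • a ∈ S} =
      Nat.card {b : X // b ∈ MulAction.orbit G a ∧ b ∈ S} *
        Nat.card (MulAction.stabilizer G a) := by
  rw [← Nat.card_congr (Equiv.subtypeSubtypeEquivSubtypeInter _ _), ← Nat.card_prod]
  refine Nat.card_congr (.trans ?_ Equiv.prodSubtypeFstEquivSubtypeProd)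
  exact (MulAction.orbitProdStabilizerEquivGroup G a).symm.subtypeEquiv fun _ => Iff.rfl

theorem transporterCard_eq_mul_card_centralizer (P : Subgroup G) (x : G) :
    transporterCard P x =
      Nat.card {u : G // IsConj u x ∧ u ∈ P} * Nat.card (Subgroup.centralizer {x}) := by
  refine (card_smul_mem_eq_mul_card_stabilizer (G := ConjAct G) (P : Set G) x).trans ?_
  simp only [ConjAct.mem_orbit_conjAct, ConjAct.stabilizer_eq_centralizer]
  rfl

variable {p : ℕ}

theorem mem_inv_smul_sylow_iff {P : Sylow p G} {g x : G} : x ∈ g⁻¹ • P ↔ g * x * g⁻¹ ∈ P := by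
  rw [Sylow.smul_def, map_inv]
  exact Subgroup.mem_inv_pointwise_smul_iff

theorem transporterCard_eq_sylowCount_mul_card_normalizer [Fact p.Prime] [Finite (Sylow p G)]
    (P : Sylow p G) (x : G) :
    transporterCard (P : Subgroup G) x =
      sylowCount p x * Nat.card (Subgroup.normalizer (P : Set G)) := by
  have hcard := card_smul_mem_eq_mul_card_stabilizer (G := G) {Q : Sylow p G | x ∈ Q} P
  simp only [MulAction.orbit_eq_univ, Set.mem_univ, true_and, P.stabilizer_eq_normalizer] at hcard
  refine Eq.trans ?_ hcard
  exact Nat.card_congr ((Equiv.inv G).subtypeEquiv fun g => mem_inv_smul_sylow_iff.symm)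

namespace IsPElement

theorem map [Fact p.Prime] {x : G} (hx : IsPElement p x) {H : Type*} [Group H] (f : G →* H) :
    IsPElement p (f x) := by
  obtain ⟨j, hj⟩ := hx
  exact ((Nat.dvd_prime_pow Fact.out).1 (hj ▸ orderOf_map_dvd f x)).imp fun _ => And.right

theorem exists_mem_sylow {x : G} (hx : IsPElement p x) : ∃ P : Sylow p G, x ∈ P := by
  obtain ⟨j, hj⟩ := hx
  have hzpowers : IsPGroup p (Subgroup.zpowers x) := .of_card (by rw [Nat.card_zpowers, hj])
  exact hzpowers.exists_le_sylow.imp fun _ hP => hP (Subgroup.mem_zpowers x)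

theorem exists_conj_mem_sylow [Fact p.Prime] [Finite (Sylow p G)] {x : G} (hx : IsPElement p x)
    (P : Sylow p G) : ∃ g : G, g * x * g⁻¹ ∈ P := by
  obtain ⟨Q, hQ⟩ := hx.exists_mem_sylow
  obtain ⟨g, rfl⟩ := MulAction.exists_smul_eq G P Q
  exact ⟨g⁻¹, mem_inv_smul_sylow_iff.1 (by rwa [inv_inv])⟩

end IsPElement

theorem sylowCount_pos_iff [Finite G] [Fact p.Prime] {x : G} :
    0 < sylowCount p x ↔ IsPElement p x := by
  rw [sylowCount, Finite.card_pos_iff, nonempty_subtype]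
  exact ⟨fun ⟨P, hP⟩ => .of_mem P.2 hP, fun hx => hx.exists_mem_sylow⟩

theorem transporterCard_eq_card_mul_of_isPGroup {N : Subgroup G} [N.Normal] (hN : IsPGroup p N)
    (P : Sylow p G) (x : G) :
    transporterCard (P : Subgroup G) x =
      Nat.card N * transporterCard ((P : Subgroup G).map (QuotientGroup.mk' N)) x := by
  refine Eq.trans ?_ (QuotientGroup.card_preimage_mk N
    {g : G ⧸ N | g * x * g⁻¹ ∈ (P : Subgroup G).map (QuotientGroup.mk' N)})
  refine Nat.card_congr (Equiv.subtypeEquivRight fun g => ?_)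
  change _ ↔ QuotientGroup.mk' N (g * x * g⁻¹) ∈ (P : Subgroup G).map (QuotientGroup.mk' N)
  rw [← Subgroup.mem_comap, Subgroup.comap_map_eq, QuotientGroup.ker_mk',
    sup_eq_left.2 (hN.le_sylow_of_normal P)]

section Coprime

variable [Finite G] [Fact p.Prime] {N : Subgroup G}

theorem disjoint_of_isPGroup_of_coprime {P : Subgroup G} (hP : IsPGroup p P)
    (hN : (Nat.card N).Coprime p) : Disjoint P N := by
  obtain ⟨j, hj⟩ := IsPGroup.iff_card.1 hP
  exact Subgroup.disjoint_of_coprime_natCard (hj ▸ (hN.pow_right j).symm)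

variable [N.Normal]

/-- By Sylow's theorem in the preimage of the centralizer of the common image, one may assume that
the two elements lie in the same `p`-subgroup, which meets `N` trivially. -/
theorem IsPElement.isConj_of_mk_eq (hN : (Nat.card N).Coprime p) {x y : G} (hx : IsPElement p x)
    (hy : IsPElement p y) (h : (x : G ⧸ N) = y) : IsConj x y := by
  let K : Subgroup G := (Subgroup.centralizer {(y : G ⧸ N)}).comap (QuotientGroup.mk' N)
  have mem_K {g : G} : g ∈ K ↔ (g * y : G ⧸ N) = y * g := Subgroup.mem_centralizer_singleton_iff
  have isPElement_K {g : K} : IsPElement p g ↔ IsPElement p (g : G) := by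
    simp only [IsPElement, Subgroup.orderOf_coe]
  obtain ⟨S, hS⟩ := (isPElement_K (g := ⟨y, mem_K.2 rfl⟩)).2 hy |>.exists_mem_sylow
  obtain ⟨⟨g, hg⟩, hgS⟩ :=
    (isPElement_K (g := ⟨x, mem_K.2 (by rw [h])⟩)).2 hx |>.exists_conj_mem_sylow S
  have hdisjoint := disjoint_of_isPGroup_of_coprime (S.2.map K.subtype) hN
  refine isConj_iff.2 ⟨g, mul_inv_eq_one.1 (Subgroup.disjoint_def.1 hdisjoint ?_ ?_)⟩
  · exact Subgroup.mem_map_of_mem K.subtype (S.mul_mem hgS (S.inv_mem hS))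
  · rw [← QuotientGroup.eq_one_iff]
    simp only [QuotientGroup.mk_mul, QuotientGroup.mk_inv]
    rw [h, mem_K.1 hg, mul_inv_cancel_right, mul_inv_cancel]

theorem card_isConj_mem_eq_of_coprime (hN : (Nat.card N).Coprime p) {P : Subgroup G}
    (hP : IsPGroup p P) {x : G} (hx : IsPElement p x) :
    Nat.card {u : G // IsConj u x ∧ u ∈ P} =
      Nat.card {v : G ⧸ N // IsConj v x ∧ v ∈ P.map (QuotientGroup.mk' N)} := by
  refine Nat.card_eq_of_bijective (fun u => ⟨u.1, (QuotientGroup.mk' N).map_isConj u.2.1,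
    Subgroup.mem_map_of_mem _ u.2.2⟩) ⟨?_, ?_⟩
  · rintro ⟨u, _, hu⟩ ⟨v, _, hv⟩ h
    have hmem : u⁻¹ * v ∈ N := QuotientGroup.eq.1 (congrArg Subtype.val h)
    exact Subtype.ext (inv_mul_eq_one.1 (Subgroup.disjoint_def.1
      (disjoint_of_isPGroup_of_coprime hP hN) (P.mul_mem (P.inv_mem hu) hv) hmem))
  · rintro ⟨_, hconj, u, hu, rfl⟩
    obtain ⟨g, hg⟩ := isConj_iff.1 hconj.symm
    obtain ⟨g, rfl⟩ := QuotientGroup.mk_surjective g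
    have hux : IsConj (g * x * g⁻¹) u :=
      (isPElement_conj_iff.2 hx).isConj_of_mk_eq hN (.of_mem hP hu) hg
    exact ⟨⟨u, (isConj_iff.2 ⟨g, rfl⟩ |>.trans hux).symm, hu⟩, rfl⟩

theorem transporterCard_mul_card_centralizer_of_coprime (hN : (Nat.card N).Coprime p)
    {P : Subgroup G} (hP : IsPGroup p P) {x : G} (hx : IsPElement p x) :
    transporterCard P x * Nat.card (Subgroup.centralizer {(x : G ⧸ N)}) =
      transporterCard (P.map (QuotientGroup.mk' N)) x * Nat.card (Subgroup.centralizer {x}) := by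
  rw [transporterCard_eq_mul_card_centralizer, transporterCard_eq_mul_card_centralizer,
    card_isConj_mem_eq_of_coprime hN hP hx, mul_right_comm]

end Coprime

end Transporter

section PSolvable

variable {G : Type*} [Group G] {p : ℕ}

theorem relIndex_map_dvd_of_le {G' : Type*} [Group G'] (f : G →* G') {A B : Subgroup G} [A.Normal]
    (hAB : A ≤ B) : (A.map f).relIndex (B.map f) ∣ A.relIndex B := by
  have hsup : B ⊔ f.ker = B ⊔ (A ⊔ f.ker) := by rw [← sup_assoc, sup_eq_left.2 hAB]
  rw [Subgroup.relIndex_map_map, hsup, Subgroup.relIndex_sup_right]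
  exact Subgroup.relIndex_dvd_of_le_left B le_sup_left

namespace IsPSolvable

theorem quotient [Fact p.Prime] (hG : IsPSolvable p G) (N : Subgroup G) [N.Normal] :
    IsPSolvable p (G ⧸ N) := by
  obtain ⟨n, M, h0, hn, hnormal, hstep⟩ := hG
  refine ⟨n, fun i => (M i).map (QuotientGroup.mk' N), ?_, ?_,
    fun i => (hnormal i).map _ (QuotientGroup.mk'_surjective N), fun i hi => ?_⟩
  · exact (congrArg _ h0).trans (Subgroup.map_bot _)
  · exact (congrArg _ hn).trans
      (Subgroup.map_top_of_surjective _ (QuotientGroup.mk'_surjective N))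
  · obtain ⟨hle, hindex⟩ := hstep i hi
    have := hnormal i
    have hdvd := relIndex_map_dvd_of_le (QuotientGroup.mk' N) hle
    refine ⟨Subgroup.map_mono hle, hindex.imp ?_ (.of_dvd_left hdvd)⟩
    rintro ⟨k, hk⟩
    exact ((Nat.dvd_prime_pow Fact.out).1 (hk ▸ hdvd)).imp fun _ => And.right

theorem exists_normal_ne_bot [Nontrivial G] (hG : IsPSolvable p G) :
    ∃ N : Subgroup G, N.Normal ∧ N ≠ ⊥ ∧ (IsPGroup p N ∨ (Nat.card N).Coprime p) := by
  obtain ⟨n, M, h0, hn, hnormal, hstep⟩ := hG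
  by_contra! hbot
  suffices ∀ i ≤ n, M i = ⊥ from bot_ne_top ((this n le_rfl).symm.trans hn)
  intro i
  induction i with
  | zero => exact fun _ => h0
  | succ i ih =>
    intro hi
    obtain ⟨-, hindex⟩ := hstep i hi
    rw [ih (Nat.le_of_succ_le hi), Subgroup.relIndex_bot_left] at hindex
    by_contra hne
    obtain ⟨hp, hcoprime⟩ := hbot _ (hnormal _) hne
    exact hindex.elim (fun ⟨_, hk⟩ => hp (.of_card hk)) hcoprime

end IsPSolvable

end PSolvable

section CharacterTable

variable {p : ℕ} [Fact p.Prime]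

namespace CharacterTableIso

variable {G H : Type*} [Group G] [Group H] [Finite G] [Finite H] (T : CharacterTableIso G H)

theorem transporterCard_eq_of_quotient {N : Subgroup G} [N.Normal]
    (hN : IsPGroup p N ∨ (Nat.card N).Coprime p) (P : Sylow p G) (Q : Sylow p H) {x : G} {y : H}
    (h : T.cols (.mk x) = .mk y) (hx : IsPElement p x)
    (hquot : transporterCard ((P : Subgroup G).map (QuotientGroup.mk' N)) x =
      transporterCard ((Q : Subgroup H).map (QuotientGroup.mk' (T.normalMap N))) y) :
    transporterCard (P : Subgroup G) x = transporterCard (Q : Subgroup H) y := by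
  have hcard := T.card_normalMap N
  cases hN with
  | inl hN =>
    have hM : IsPGroup p (T.normalMap N) := by
      rw [IsPGroup.iff_card] at hN ⊢
      rwa [hcard]
    rw [transporterCard_eq_card_mul_of_isPGroup hN, transporterCard_eq_card_mul_of_isPGroup hM,
      hcard, hquot]
  | inr hN =>
    have hy : IsPElement p y := (T.isPElement_iff p h).1 hx
    have hG := transporterCard_mul_card_centralizer_of_coprime hN P.2 hx
    have hH := transporterCard_mul_card_centralizer_of_coprime (hcard ▸ hN) Q.2 hy
    rw [← (T.quotient N).card_centralizer_eq (T.quotient_cols_mk N h), ← T.card_centralizer_eq h,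
      ← hquot, ← hG] at hH
    exact (Nat.eq_of_mul_eq_mul_right Nat.card_pos hH).symm

theorem transporterCard_eq (hG : IsPSolvable p G) (P : Sylow p G) (Q : Sylow p H) {x : G} {y : H}
    (h : T.cols (.mk x) = .mk y) (hx : IsPElement p x) :
    transporterCard (P : Subgroup G) x = transporterCard (Q : Subgroup H) y := by
  induction hn : Nat.card G using Nat.strong_induction_on generalizing G H with
  | _ n ih =>
  subst hn
  cases subsingleton_or_nontrivial G with
  | inl _ =>
    have : Subsingleton H := by
      rwa [← Finite.card_le_one_iff_subsingleton, ← T.card_eq,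
        Finite.card_le_one_iff_subsingleton]
    rw [Subsingleton.elim x 1, Subsingleton.elim y 1, transporterCard_one, transporterCard_one,
      T.card_eq]
  | inr _ =>
    obtain ⟨N, _, hne, hN⟩ := hG.exists_normal_ne_bot
    have hlt : Nat.card (G ⧸ N) < Nat.card G := by
      rw [N.card_eq_card_quotient_mul_card_subgroup]
      exact lt_mul_of_one_lt_right Nat.card_pos (N.one_lt_card_iff_ne_bot.2 hne)
    exact T.transporterCard_eq_of_quotient hN P Q h hx <|
      ih _ hlt (T.quotient N) (hG.quotient N)
        (P.mapSurjective (QuotientGroup.mk'_surjective N))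
        (Q.mapSurjective (QuotientGroup.mk'_surjective _)) (T.quotient_cols_mk N h)
        (hx.map (QuotientGroup.mk' N)) rfl

theorem sylowCount_mul_card_normalizer_eq (hG : IsPSolvable p G) (P : Sylow p G) (Q : Sylow p H)
    {x : G} {y : H} (h : T.cols (.mk x) = .mk y) (hx : IsPElement p x) :
    sylowCount p x * Nat.card (Subgroup.normalizer (P : Set G)) =
      sylowCount p y * Nat.card (Subgroup.normalizer (Q : Set H)) := by
  rw [← transporterCard_eq_sylowCount_mul_card_normalizer,
    ← transporterCard_eq_sylowCount_mul_card_normalizer, T.transporterCard_eq hG P Q h hx]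

end CharacterTableIso

variable {G : Type*} [Group G] [Finite G]

theorem tableDeterminesSylowCount_of_tableDeterminesNormalizer (hG : IsPSolvable p G)
    {P : Sylow p G} (h : TableDeterminesNormalizer p P) : TableDeterminesSylowCount p G := by
  intro x H _ _ T y hxy
  by_cases hx : IsPElement p x
  · have hmul := T.sylowCount_mul_card_normalizer_eq hG P default hxy hx
    rw [h H ⟨T⟩ default] at hmul
    exact (Nat.eq_of_mul_eq_mul_right Nat.card_pos hmul).symm
  · have hy : ¬ IsPElement p y := (T.isPElement_iff p hxy).not.1 hx
    rw [← sylowCount_pos_iff, Nat.pos_iff_ne_zero, not_not] at hx hy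
    rw [hx, hy]

theorem tableDeterminesNormalizer_of_tableDeterminesSylowCountAt (hG : IsPSolvable p G)
    (P : Sylow p G) {x : G} (hx : IsPElement p x) (h : TableDeterminesSylowCountAt p x) :
    TableDeterminesNormalizer p P := by
  rintro H _ _ ⟨T⟩ Q
  obtain ⟨y, hy⟩ := T.exists_cols_mk_eq x
  have hmul := T.sylowCount_mul_card_normalizer_eq hG P Q hy hx
  rw [h H T y hy] at hmul
  exact (Nat.eq_of_mul_eq_mul_left (sylowCount_pos_iff.2 hx) hmul).symm

end CharacterTable

theorem mainTheorem8 {G : Type*} [Group G] [Finite G] (p : ℕ) [Fact p.Prime]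
    (hG : IsPSolvable p G) (P : Sylow p G) :
    (TableDeterminesNormalizer p P ↔ TableDeterminesSylowCount p G) ∧
    (p ∣ Nat.card G →
      List.TFAE [
        TableDeterminesNormalizer p P,
        TableDeterminesSylowCount p G,
        ∃ x : G, IsPElement p x ∧ x ≠ 1 ∧ TableDeterminesSylowCountAt p x]) := by
  have normalizer_of_sylowCountAt {x : G} (hx : IsPElement p x)
      (h : TableDeterminesSylowCountAt p x) : TableDeterminesNormalizer p P :=
    tableDeterminesNormalizer_of_tableDeterminesSylowCountAt hG P hx h
  have normalizer_iff : TableDeterminesNormalizer p P ↔ TableDeterminesSylowCount p G :=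
    ⟨tableDeterminesSylowCount_of_tableDeterminesNormalizer hG,
      fun h => normalizer_of_sylowCountAt ⟨0, orderOf_one⟩ (h 1)⟩
  refine ⟨normalizer_iff, fun hp => ?_⟩
  tfae_have 1 ↔ 2 := normalizer_iff
  tfae_have 2 → 3 := fun h => by
    obtain ⟨x, hx⟩ := exists_prime_orderOf_dvd_card' p hp
    have hne : x ≠ 1 := fun h1 => (Fact.out : p.Prime).one_lt.ne' (hx ▸ orderOf_eq_one_iff.2 h1)
    exact ⟨x, ⟨1, hx.trans (pow_one p).symm⟩, hne, h x⟩
  tfae_have 3 → 1 := fun ⟨_, hx, _, h⟩ => normalizer_of_sylowCountAt hx h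
  tfae_finish
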